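/- Model. We use the word RAM with words of $w$ bits: registers, a memory addressed by words, unit-cost word instructions and tests. An instance has parameters $(w,n,\sigma)$ with $n\le 2^w$ and $\sigma<2^w$; its input is a string $T[1..n]$ over $\{0,\dots,\sigma-1\}$. An online algorithm is a fixed program that is executed once per letter, for the letters of $T$ from left to right; the registers and the memory are initially zero, except that one register holds $\sigma$. It runs in worst-case time $t(w,n,\sigma)$ per letter if each of the $n$ rounds halts after at most $t(w,n,\sigma)$ steps, and in space $m$ if round $i$ accesses only memory cells with addresses less than $m(w,n,\sigma;i)$. Suffix tree updates. The suffix tree of a string $S$ is the compacted trie of its suffixes: its nodes are the loci of the suffixes of $S$ (including the root, the locus of the empty string) and the branching loci. An online algorithm solves $\mathrm{SuffixUpdate}$ if after each round $i\ge 1$ it stores the suffix tree of the inverted string $T[i]T[i-1]\cdots T[1]$: distinct nodes have distinct addresses, designated registers point to the root and to the leaf of the whole string, and each non-root node has a record, within the allowed space, with a pointer to its parent and two text positions $x\le y\le i$ such that the inverse of $T[x+1..y]$ is the label of the edge to its parent. Anything else (child dictionaries, Weiner links, ...) may be stored in any form. Strings. $\mathsf{LRS}[i]$ is the length of the longest suffix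 of $T[1..i]$ that occurs at least twice in $T[1..i]$. The LZ77 factorization of $T$ is the factorization $T=F_1\cdots F_z$ into nonempty factors such that each $F_x$ is either the first occurrence of a letter, or the longest prefix $G$ of $F_x\cdots F_z$ that occurs at least twice in $F_1\cdots F_{x-1}G$ (occurrences may overlap). Theorem (LZ77 online). Let $R$ be any set of parameters $(w,n,\sigma)$ as above, and suppose that some online algorithm solves $\mathrm{SuffixUpdate}$ for all inputs with parameters in $R$, in worst-case time $t_{SU}=t_{SU}(w,n,\sigma)$ per letter and in space $m$. Then the LZ77 factorization can be computed online in $O(t_{SU})$ worst-case time per letter: there are an online algorithm and a constant $C$ such that, for every input $T$ with parameters in $R$, the algorithm runs in worst-case time $C\cdot t_{SU}$ per letter and in the same space $m$, and in each round $i=1,\dots,n$ it reports $\mathsf{LRS}[i]$, the start of the factor that contains position $i$, and whether $i$ starts a new factor, in such a way that for each $i\le n$ the reports of rounds $1,\dots,i$ describe the (existing and unique) LZ77 factorization of $T[1..i]$; in particular, after round $n$ they describe that of $T$. Moreover, for each $i>1$ the algorithm's decision is given by comparing $i-\mathsf{LRS}[i]+1$ with the start $s$ of the factor that is current after round $i-1$: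 if $i-\mathsf{LRS}[i]+1\le s$, then position $i$ extends the current factor, and otherwise the current factor ends at $i-1$ and $i$ starts a new one. This rule is correct for every string $T$, with $\mathsf{LRS}[i]$ as defined and $s$ the start of the factor of the LZ77 factorization of $T$ that contains position $i-1$. -/

import Mathlib

namespace LZOnline

/-! ### Strings: occurrences, longest repeating suffixes, LZ77 factorization

Positions are 1-based: `T.take i` is `T[1..i]`. -/

/-- The number of occurrences (starting positions) of `P` in `S`. -/
def occ (P S : List ℕ) : ℕ :=
  ((Finset.range (S.length + 1)).filter (fun j => P <+: S.drop j)).card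

/-- `LRS[i]`: the length of the longest suffix of `T[1..i]` that occurs at least twice in
`T[1..i]`. -/
def lrs (T : List ℕ) (i : ℕ) : ℕ :=
  Nat.findGreatest (fun l => 2 ≤ occ ((T.take i).drop (i - l)) (T.take i)) i

/-- `F = [F₁, …, F_z]` is the LZ77 factorization of `T`: the factors are nonempty, their
concatenation is `T`, and each factor is either the first occurrence of a letter, or the longest
prefix `g` of the remaining text `F_x ⋯ F_z` that occurs at least twice in `F₁ ⋯ F_{x-1} g`
(the two occurrences may overlap). -/
def IsLZ77 (T : List ℕ) (F : List (List ℕ)) : Prop :=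
  F.flatten = T ∧
  ∀ (x : ℕ) (hx : x < F.length),
    (∃ a, F[x] = [a] ∧ a ∉ (F.take x).flatten) ∨
    (F[x] ≠ [] ∧ 2 ≤ occ F[x] ((F.take x).flatten ++ F[x]) ∧
      ∀ g, g <+: (F.drop x).flatten → 2 ≤ occ g ((F.take x).flatten ++ g) →
        g.length ≤ F[x].length)

/-- The starting positions of the factors. -/
def starts (F : List (List ℕ)) : Finset ℕ :=
  (Finset.range F.length).image (fun x => (F.take x).flatten.length + 1)

/-- The starting position of the factor that contains position `j`
(the last factor start that is at most `j`). -/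
def currentStart (F : List (List ℕ)) (j : ℕ) : ℕ :=
  ((starts F).filter (fun k => k ≤ j)).sup id

/-! ### The suffix tree

The compacted trie of all suffixes of `S`. A node is identified with its label (the string spelled
out from the root). The nodes are the loci of the suffixes (the root is the empty one) and the
branching loci. -/

/-- `u` is the label of a node of the suffix tree of `S`. -/
def IsNode (S u : List ℕ) : Prop :=
  u <:+ S ∨ ∃ a b, a ≠ b ∧ (u ++ [a]) <:+: S ∧ (u ++ [b]) <:+: S

/-- `p` is the parent of `v` in the suffix tree of `S`. -/
def IsParent (S p v : List ℕ) : Prop :=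
  IsNode S p ∧ p <+: v ∧ p ≠ v ∧ ∀ q, IsNode S q → q <+: v → q ≠ v → q <+: p

/-! ### The word RAM

Words have `w` bits; a machine has registers (a program mentions finitely many of them) and a
memory whose cells are addressed by words. Every instruction and every test costs one step. -/

/-- The contents of the registers and of the memory. -/
@[ext]
structure State (w : ℕ) where
  reg : ℕ → BitVec w
  mem : BitVec w → BitVec w

/-- Assign a value to a register. -/
def State.setReg {w : ℕ} (s : State w) (r : ℕ) (v : BitVec w) : State w :=
  { s with reg := Function.update s.reg r v }

/-- Write a value to a memory cell. -/
def State.setMem {w : ℕ} (s : State w) (a v : BitVec w) : State w :=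
  { s with mem := Function.update s.mem a v }

/-- Binary operations on words. -/
inductive Op
  | add | sub | mul | div | mod | band | bor | bxor | shl | shr | lt | eq

/-- Unsigned arithmetic modulo `2 ^ w`, bitwise operations, shifts and comparisons. -/
def Op.eval {w : ℕ} : Op → BitVec w → BitVec w → BitVec w
  | .add, x, y => x + y
  | .sub, x, y => x - y
  | .mul, x, y => x * y
  | .div, x, y => x / y
  | .mod, x, y => x % y
  | .band, x, y => x &&& y
  | .bor, x, y => x ||| y
  | .bxor, x, y => x ^^^ y
  | .shl, x, y => x <<< y
  | .shr, x, y => x >>> y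
  | .lt, x, y => if x < y then 1 else 0
  | .eq, x, y => if x = y then 1 else 0

/-- Word RAM programs. -/
inductive Prog
  /-- `r := c` -/
  | const (r c : ℕ)
  /-- `r := a ∘ b` for registers `a`, `b` -/
  | op (o : Op) (r a b : ℕ)
  /-- `r := mem[a]`, the address being the content of register `a` -/
  | load (r a : ℕ)
  /-- `mem[a] := b`, the address being the content of register `a` -/
  | store (a b : ℕ)
  /-- sequential composition -/
  | seq (P Q : Prog)
  /-- `if r ≠ 0 then P else Q` -/
  | branch (r : ℕ) (P Q : Prog)
  /-- `while r ≠ 0 do P` -/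
  | loop (r : ℕ) (P : Prog)

/-- `Exec M P s s' t`: started in state `s`, the program `P` halts in state `s'` after exactly
`t` steps, and all memory cells that it accesses have addresses less than `M`. -/
inductive Exec {w : ℕ} (M : ℕ) : Prog → State w → State w → ℕ → Prop
  | const (s : State w) (r c : ℕ) :
      Exec M (.const r c) s (s.setReg r (BitVec.ofNat w c)) 1
  | op (s : State w) (o : Op) (r a b : ℕ) :
      Exec M (.op o r a b) s (s.setReg r (o.eval (s.reg a) (s.reg b))) 1
  | load (s : State w) (r a : ℕ) (h : (s.reg a).toNat < M) :
      Exec M (.load r a) s (s.setReg r (s.mem (s.reg a))) 1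
  | store (s : State w) (a b : ℕ) (h : (s.reg a).toNat < M) :
      Exec M (.store a b) s (s.setMem (s.reg a) (s.reg b)) 1
  | seq {P Q : Prog} {s s' s'' : State w} {t t' : ℕ} (h : Exec M P s s' t)
      (h' : Exec M Q s' s'' t') : Exec M (.seq P Q) s s'' (t + t')
  | branch_true {r : ℕ} {P Q : Prog} {s s' : State w} {t : ℕ} (h0 : s.reg r ≠ 0)
      (h : Exec M P s s' t) : Exec M (.branch r P Q) s s' (t + 1)
  | branch_false {r : ℕ} {P Q : Prog} {s s' : State w} {t : ℕ} (h0 : s.reg r = 0)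
      (h : Exec M Q s s' t) : Exec M (.branch r P Q) s s' (t + 1)
  | loop_true {r : ℕ} {P : Prog} {s s' s'' : State w} {t t' : ℕ} (h0 : s.reg r ≠ 0)
      (h : Exec M P s s' t) (h' : Exec M (.loop r P) s' s'' t') :
      Exec M (.loop r P) s s'' (t + t' + 1)
  | loop_false {r : ℕ} {P : Prog} {s : State w} (h0 : s.reg r = 0) :
      Exec M (.loop r P) s s 1

/-! ### Online algorithms -/

/-- Parameters of an instance: the word size `w` in bits, the length `n` of the input string and
the alphabet size `σ` (the letters are `0, …, σ - 1`). Here `w ≥ log n`, and the alphabet size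
fits into a word. -/
structure Params where
  w : ℕ
  n : ℕ
  σ : ℕ
  le_w : n ≤ 2 ^ w
  σ_lt : σ < 2 ^ w

/-- `T` is a string of length `n` over the alphabet of size `σ`. -/
def Params.IsInput (p : Params) (T : List ℕ) : Prop :=
  T.length = p.n ∧ ∀ a ∈ T, a < p.σ

/-- Registers and memory are zero at the beginning, except that register `1` holds `σ`. -/
def initial (p : Params) : State p.w :=
  State.setReg ⟨fun _ => 0, fun _ => 0⟩ 1 (BitVec.ofNat p.w p.σ)

/-- `s 0, s 1, …, s n` are the states of the online algorithm that executes the program `P` once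
for each letter of `T`, from left to right, the letter being supplied in register `0` at the
beginning of the round; `s i` is the state after `i` rounds. Each round takes at most `time`
steps, and round `i` accesses only the first `space i` memory cells. -/
def RunsOnline (P : Prog) (p : Params) (T : List ℕ) (time : ℕ) (space : ℕ → ℕ)
    (s : ℕ → State p.w) : Prop :=
  s 0 = initial p ∧
  ∀ (i : ℕ) (hi : i < T.length), ∃ t ≤ time,
    Exec (space (i + 1)) P ((s i).setReg 0 (BitVec.ofNat p.w T[i])) (s (i + 1)) t

/-- An online algorithm that maintains a suffix tree: a program for one round, the registers that
point to the root and to the leaf of the whole string, and the offsets, inside the memory record of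
a node, of the pointer to its parent and of the two ends of the label of the edge to its parent. -/
structure SuffixTreeAlg where
  prog : Prog
  rootReg : ℕ
  leafReg : ℕ
  parentOff : ℕ
  fromOff : ℕ
  toOff : ℕ

/-- The state `s` stores the suffix tree of the inverted string of `T`: distinct nodes have
distinct addresses, and the record of each node other than the root consists of a pointer to its
parent and of the label of the edge to its parent, given by two text positions `x ≤ y`
that delimit the inverted label `T[x+1..y]`. The records lie among the first `M` memory cells.
Whatever else is stored (child dictionaries, Weiner links, marks, …) is up to the algorithm. -/
def SuffixTreeAlg.Stores (A : SuffixTreeAlg) {w : ℕ} (M : ℕ) (s : State w) (T : List ℕ) : Prop :=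
  ∃ addr : List ℕ → BitVec w,
    Set.InjOn addr {u | IsNode T.reverse u} ∧
    s.reg A.rootReg = addr [] ∧
    s.reg A.leafReg = addr T.reverse ∧
    ∀ v u, IsNode T.reverse v → IsParent T.reverse u v →
      (∀ k ∈ [A.parentOff, A.fromOff, A.toOff],
        (addr v).toNat + k < M ∧ (addr v).toNat + k < 2 ^ w) ∧
      s.mem (addr v + BitVec.ofNat w A.parentOff) = addr u ∧
      ∃ x y : ℕ, x ≤ y ∧ y ≤ T.length ∧
        (s.mem (addr v + BitVec.ofNat w A.fromOff)).toNat = x ∧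
        (s.mem (addr v + BitVec.ofNat w A.toOff)).toNat = y ∧
        v = u ++ ((T.take y).drop x).reverse

/-- `A` solves `SuffixUpdate` for all instances with parameters in `R`, in worst-case time `time`
per letter and within the given space: whenever a letter is appended to the text (that is,
prepended to the inverted text), the stored suffix tree is updated accordingly. -/
def SuffixTreeAlg.SolvesSuffixUpdate (A : SuffixTreeAlg) (R : Set Params) (time : Params → ℕ)
    (space : Params → ℕ → ℕ) : Prop :=
  ∀ p ∈ R, ∀ T, p.IsInput T → ∃ s : ℕ → State p.w,
    RunsOnline A.prog p T (time p) (space p) s ∧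
    ∀ i, 1 ≤ i → i ≤ p.n → A.Stores (space p i) (s i) (T.take i)

/-- An online algorithm for LZ77: a program for one round and the registers in which, at the end of
round `i`, it reports `LRS[i]`, the start of the current factor, and whether position `i` starts a
new factor (`1`) or extends the current one (`0`). -/
structure LZAlg where
  prog : Prog
  lrsReg : ℕ
  startReg : ℕ
  flagReg : ℕ

/-- `B` computes the LZ77 factorization online for all instances with parameters in `R`, in
worst-case time `time` per letter and within the given space: after each round `i`, what has been
reported in rounds `1, …, i` describes the LZ77 factorization of `T[1..i]` (in particular, after
round `n`, that of `T`). The decision at position `i` is made by comparing `i - LRS[i] + 1` with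
the start of the factor that is current before round `i`. -/
def LZAlg.ComputesLZ77 (B : LZAlg) (R : Set Params) (time : Params → ℕ)
    (space : Params → ℕ → ℕ) : Prop :=
  ∀ p ∈ R, ∀ T, p.IsInput T → ∃ s : ℕ → State p.w,
    RunsOnline B.prog p T (time p) (space p) s ∧
    (∀ i ≤ p.n, ∃ F, IsLZ77 (T.take i) F ∧ (∀ F', IsLZ77 (T.take i) F' → F' = F) ∧
      ∀ j, 1 ≤ j → j ≤ i →
        (s j).reg B.flagReg = (if j ∈ starts F then 1 else 0) ∧
        ((s j).reg B.startReg).toNat = currentStart F j) ∧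
    (∀ i, 1 ≤ i → i ≤ p.n → ((s i).reg B.lrsReg).toNat = lrs T i) ∧
    (∀ i, 1 < i → i ≤ p.n →
      (s i).reg B.flagReg =
        if i - ((s i).reg B.lrsReg).toNat + 1 ≤ ((s (i - 1)).reg B.startReg).toNat
        then 0 else 1)

end LZOnline

namespace LZOnline

/-! Let `S` be the inverse of `T[1..i]`. A node of its suffix tree that is a proper prefix of `S`
has a second occurrence in `S`, so its inverse is a repeating suffix of the text. Conversely, the
inverse of the longest repeating suffix is a node: its other occurrence either starts the text, or
is preceded by a different letter, since otherwise the repeat would be longer. So the parent of the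
leaf has depth `LRS[i]` (`exists_isParent_length_eq_lrs`), and the two text positions stored at the
leaf differ by `i - LRS[i]`.

For the factor starting at `s < i`, the string `T[s..i]` has length at least 2 and occurs earlier
exactly when it fits into the factor (`IsFactor.occursBefore_iff`); it occurs earlier exactly when
`i - s + 1 ≤ LRS[i]`. This is the rule `IsLZ77.mem_starts_iff`. It uses only prefixes of `T`, so
reports never have to be revised (`IsLZ77.currentStart_eq`).

The machine runs the given round and then a constant-time report on fresh registers, which the given
program neither reads nor writes (`Exec.overlay`). -/

/-! ### Repeated suffixes -/

/-- `P` occurs in `W` somewhere else than at the end. -/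
def OccursBefore (P W : List ℕ) : Prop :=
  ∃ a b, b ≠ [] ∧ a ++ P ++ b = W

/-- The occurrence at the end always counts; any other one leaves a nonempty remainder to its right.
-/
theorem two_le_occ_iff {P W : List ℕ} (h : P <:+ W) : 2 ≤ occ P W ↔ OccursBefore P W := by
  obtain ⟨p, rfl⟩ := h
  have hp : p.length ∈ (Finset.range ((p ++ P).length + 1)).filter
      (fun j => P <+: (p ++ P).drop j) := by
    simp
  constructor
  · intro h2
    obtain ⟨j, hj, hne⟩ := Finset.exists_mem_ne (by exact h2) p.length
    simp only [Finset.mem_filter, Finset.mem_range] at hj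
    obtain ⟨hj, b, hb⟩ := hj
    refine ⟨(p ++ P).take j, b, ?_, ?_⟩
    · rintro rfl
      have := congrArg List.length hb
      simp at this hj
      omega
    · rw [List.append_assoc, hb, List.take_append_drop]
  · rintro ⟨a, b, hb, hab⟩
    have hl := congrArg List.length hab
    have hb' := List.length_pos_iff.2 hb
    simp only [List.length_append] at hl
    refine Finset.one_lt_card.2 ⟨a.length, ?_, p.length, hp, by omega⟩
    simp only [Finset.mem_filter, Finset.mem_range, List.length_append]
    refine ⟨by omega, ?_⟩
    rw [← hab, List.append_assoc, List.drop_left]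
    exact List.prefix_append _ _

theorem OccursBefore.of_suffix {P Q W : List ℕ} (h : OccursBefore P W) (hQ : Q <:+ P) :
    OccursBefore Q W := by
  obtain ⟨a, b, hb, rfl⟩ := h
  obtain ⟨c, rfl⟩ := hQ
  exact ⟨a ++ c, b, hb, by simp⟩

/-- Cutting `h` off both occurrences preserves their distance, which is the length of `b`. -/
theorem OccursBefore.of_prefix {p g h : List ℕ} (H : OccursBefore (g ++ h) (p ++ (g ++ h))) :
    OccursBefore g (p ++ g) := by
  obtain ⟨a, b, hb, hab⟩ := H
  have hl := congrArg List.length hab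
  have hb' := List.length_pos_iff.2 hb
  simp only [List.length_append] at hl
  have h1 : a ++ g <+: p ++ (g ++ h) := ⟨h ++ b, by rw [← hab]; simp⟩
  have h2 : p ++ g <+: p ++ (g ++ h) := ⟨h, by simp⟩
  obtain ⟨c, hc⟩ := List.prefix_of_prefix_length_le h1 h2 (by simp; omega)
  refine ⟨a, c, ?_, hc⟩
  rintro rfl
  have := congrArg List.length hc
  simp at this
  omega

theorem OccursBefore.mem_of_cons {a : ℕ} {p g : List ℕ}
    (H : OccursBefore (a :: g) (p ++ a :: g)) : a ∈ p := by
  obtain ⟨q, b, hb, hq⟩ := OccursBefore.of_prefix (g := [a]) (h := g) H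
  have h1 : q ++ [a] <+: p ++ [a] := ⟨b, hq⟩
  have hl := congrArg List.length hq
  have hb' := List.length_pos_iff.2 hb
  simp only [List.length_append, List.length_singleton] at hl
  exact (List.prefix_of_prefix_length_le h1 (List.prefix_append p [a]) (by simp; omega)).subset
    (by simp)

theorem occursBefore_singleton {a : ℕ} {p : List ℕ} : OccursBefore [a] (p ++ [a]) ↔ a ∈ p := by
  refine ⟨fun h => h.mem_of_cons, fun h => ?_⟩
  obtain ⟨s, t, rfl⟩ := List.append_of_mem h
  exact ⟨s, t ++ [a], by simp, by simp⟩

/-- Suffixes of repeating suffixes repeat, so the maximum is a threshold. -/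
theorem le_lrs_iff {T : List ℕ} {i l : ℕ} (hi : 1 ≤ i) (hT : i ≤ T.length) (hl : l ≤ i) :
    l ≤ lrs T i ↔ OccursBefore ((T.take i).drop (i - l)) (T.take i) := by
  rw [← two_le_occ_iff (List.drop_suffix _ _)]
  constructor
  · intro h
    -- `Nat.findGreatest` also returns 0 when no length qualifies; the empty suffix of a nonempty
    -- text does repeat, so the value 0 is genuine.
    have h0 : 2 ≤ occ ((T.take i).drop (i - 0)) (T.take i) := by
      rw [two_le_occ_iff (List.drop_suffix _ _)]
      refine ⟨[], T.take i, ?_, ?_⟩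
      · rw [Ne, List.take_eq_nil_iff]
        rintro (h | rfl)
        · omega
        · simp at hT
          omega
      · simp
    have hs := Nat.findGreatest_spec
      (P := fun l => 2 ≤ occ ((T.take i).drop (i - l)) (T.take i)) (Nat.zero_le i) h0
    rw [two_le_occ_iff (List.drop_suffix _ _)] at hs ⊢
    exact hs.of_suffix (List.drop_suffix_drop_left _ (by unfold lrs at h; omega))
  · exact fun h => Nat.le_findGreatest hl h

theorem lrs_le (T : List ℕ) (i : ℕ) : lrs T i ≤ i := Nat.findGreatest_le i

theorem lrs_lt {T : List ℕ} {i : ℕ} (hi : 1 ≤ i) (hT : i ≤ T.length) : lrs T i < i := by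
  by_contra! h
  obtain ⟨a, b, hb, hab⟩ := (le_lrs_iff hi hT le_rfl).1 h
  have hl := congrArg List.length hab
  have hb' := List.length_pos_iff.2 hb
  simp at hl
  omega

theorem lrs_take {T : List ℕ} {i j : ℕ} (h : j ≤ i) : lrs (T.take i) j = lrs T j := by
  simp [lrs, List.take_take, min_eq_left h]

/-! ### The parent of the leaf of the whole string -/

theorem occursBefore_reverse_of_isNode {S q : List ℕ} (hn : IsNode S q) (hp : q <+: S)
    (hne : q ≠ S) : OccursBefore q.reverse S.reverse := by
  obtain ⟨d, rfl⟩ := hp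
  rcases hn with ⟨e, he⟩ | ⟨a, b, hab, ⟨x, y, hx⟩, ⟨x', y', hx'⟩⟩
  · refine ⟨[], e.reverse, ?_, ?_⟩
    · intro h
      rw [List.reverse_eq_nil_iff] at h
      subst h
      exact hne (by simpa using he)
    · rw [← he]
      simp
  -- Of two occurrences of `q` followed by different letters, at most one is at the start of `S`;
  -- the other one is the repeat.
  · by_cases h : x = []
    · have h' : x' ≠ [] := by
        rintro rfl
        subst h
        rw [← hx'] at hx
        simp at hx
        exact hab hx.1
      exact ⟨([b] ++ y').reverse, x'.reverse, by simpa using h', by rw [← hx']; simp⟩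
    · exact ⟨([a] ++ y).reverse, x.reverse, by simpa using h, by rw [← hx]; simp⟩

theorem exists_isParent_length_eq_lrs {T : List ℕ} {i : ℕ} (hi : 1 ≤ i) (hT : i ≤ T.length) :
    ∃ u, IsParent (T.take i).reverse u (T.take i).reverse ∧ u.length = lrs T i := by
  have hlt := lrs_lt hi hT
  have hlen : (T.take i).length = i := by simp [hT]
  have key := fun l (hl : l ≤ i) => le_lrs_iff hi hT hl
  set l := lrs T i with hldef
  set W := T.take i with hW
  obtain ⟨a, b, hb, hab⟩ := (key l hlt.le).1 le_rfl
  set P := W.drop (i - l) with hP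
  have hPl : P.length = l := by simp [hP, hlen]; omega
  have hpre : P.reverse <+: W.reverse := List.reverse_prefix.2 (List.drop_suffix _ _)
  have hne : P.reverse ≠ W.reverse := fun h => by
    have := congrArg List.length h
    simp only [List.length_reverse] at this
    omega
  refine ⟨P.reverse, ⟨?_, hpre, hne, ?_⟩, by simpa using hPl⟩
  -- If the earlier occurrence starts the text, the inverse of `P` is a suffix of the inverted text;
  -- otherwise the letters `z` and `c` preceding the two occurrences make it branch.
  · rcases List.eq_nil_or_concat a with rfl | ⟨a', z, rfl⟩
    · left
      rw [← hab]
      simp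
    · right
      have hWP : W.take (i - l) ++ P = W := List.take_append_drop _ _
      rcases List.eq_nil_or_concat (W.take (i - l)) with h0 | ⟨p, c, hc⟩
      · rw [h0, List.nil_append] at hWP
        exact absurd (by rw [hWP]) hne
      · rw [hc, List.concat_eq_append] at hWP
        rw [List.concat_eq_append] at hab
        refine ⟨z, c, ?_, ⟨b.reverse, a'.reverse, by rw [← hab]; simp⟩,
          ⟨[], p.reverse, by rw [← hWP]; simp⟩⟩
        rintro rfl
        -- Equal preceding letters would give a repeating suffix of length `l + 1`.
        have hd : W.drop (i - (l + 1)) = z :: P := by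
          have hpl := congrArg List.length hWP
          simp only [List.length_append, List.length_singleton] at hpl
          rw [show i - (l + 1) = p.length by omega]
          conv_lhs => rw [← hWP]
          simp
        have := (key (l + 1) hlt).2 ⟨a', b, hb, by rw [hd, ← hab]; simp⟩
        omega
  · intro q hq hqp hqne
    have hr := occursBefore_reverse_of_isNode hq hqp hqne
    rw [List.reverse_reverse] at hr
    have hql : q.length ≤ i := by simpa [hlen] using hqp.length_le
    have hqs : q.reverse <:+ W := by
      rw [← List.reverse_prefix]
      simpa using hqp
    have heq : W.drop (i - q.length) = q.reverse := by
      have := List.suffix_iff_eq_drop.1 hqs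
      rw [List.length_reverse, hlen] at this
      exact this.symm
    have := (key q.length hql).2 (by rw [heq]; exact hr)
    exact List.prefix_of_prefix_length_le hqp hpre (by simp; omega)

/-! ### The rule for the factor starts -/

/-- The first factor of the LZ77 factorization of `R` after the text `P`. -/
def IsFactor (P R f : List ℕ) : Prop :=
  (∃ a, f = [a] ∧ a ∉ P) ∨
    (f ≠ [] ∧ 2 ≤ occ f (P ++ f) ∧
      ∀ g, g <+: R → 2 ≤ occ g (P ++ g) → g.length ≤ f.length)

theorem IsFactor.ne_nil {P R f : List ℕ} (h : IsFactor P R f) : f ≠ [] := by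
  rcases h with ⟨a, rfl, -⟩ | ⟨h, -⟩
  · simp
  · exact h

/-- For a fresh letter both sides fail: `g` begins with that letter and is longer than `f`. At
length 1 the equivalence would break in this case. Otherwise maximality gives one direction and
truncation of `f` the other. -/
theorem IsFactor.occursBefore_iff {P R f g : List ℕ} (h : IsFactor P R f) (hf : f <+: R)
    (hg : g <+: R) (hg2 : 2 ≤ g.length) :
    OccursBefore g (P ++ g) ↔ g.length ≤ f.length := by
  rcases h with ⟨a, rfl, ha⟩ | ⟨hne, hocc, hmax⟩
  · constructor
    · intro H
      obtain ⟨c, rfl⟩ := List.prefix_of_prefix_length_le hf hg (by simp; omega)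
      exact absurd H.mem_of_cons ha
    · intro H
      simp at H
      omega
  · constructor
    · intro H
      exact hmax g hg ((two_le_occ_iff (List.suffix_append _ _)).2 H)
    · intro H
      obtain ⟨c, rfl⟩ := List.prefix_of_prefix_length_le hg hf H
      exact ((two_le_occ_iff (List.suffix_append _ _)).1 hocc).of_prefix

theorem IsLZ77.isFactor {T : List ℕ} {F : List (List ℕ)} (h : IsLZ77 T F) {x : ℕ}
    (hx : x < F.length) : IsFactor (F.take x).flatten (F.drop x).flatten F[x] :=
  h.2 x hx

theorem length_flatten_take_succ {F : List (List ℕ)} {x : ℕ} (hx : x < F.length) :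
    (F.take (x + 1)).flatten.length = (F.take x).flatten.length + F[x].length := by
  rw [List.take_succ_eq_append_getElem hx, List.flatten_append, List.length_append,
    List.flatten_singleton]

theorem length_flatten_take_mono (F : List (List ℕ)) :
    Monotone (fun x => (F.take x).flatten.length) := by
  intro x y hxy
  have : (F.take x) <+: (F.take y) := List.take_prefix_take_left hxy
  obtain ⟨c, hc⟩ := this
  simp only [← hc, List.flatten_append, List.length_append]
  omega

theorem mem_starts {F : List (List ℕ)} {k : ℕ} :
    k ∈ starts F ↔ ∃ x < F.length, (F.take x).flatten.length + 1 = k := by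
  simp [starts]

theorem currentStart_zero (F : List (List ℕ)) : currentStart F 0 = 0 := by
  rw [currentStart, Finset.filter_false_of_mem]
  · rfl
  · intro k hk
    obtain ⟨x, -, rfl⟩ := mem_starts.1 hk
    omega

theorem currentStart_succ (F : List (List ℕ)) (j : ℕ) :
    currentStart F (j + 1) = if j + 1 ∈ starts F then j + 1 else currentStart F j := by
  unfold currentStart
  split_ifs with h
  · apply le_antisymm
    · exact Finset.sup_le fun k hk => (Finset.mem_filter.1 hk).2
    · exact Finset.le_sup (f := id) (Finset.mem_filter.2 ⟨h, le_rfl⟩)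
  · congr 1
    refine Finset.filter_congr fun k hk => ⟨fun hle => ?_, fun hle => by omega⟩
    rcases Nat.lt_or_ge j k with hlt | hge
    · exact absurd (show j + 1 ∈ starts F by rwa [show j + 1 = k by omega]) h
    · exact hge

/-- The witness is the last factor that starts at or before `j`; it reaches `j`, as the next one
starts later or does not exist. -/
theorem exists_factor_of_pos {T : List ℕ} {F : List (List ℕ)} (h : IsLZ77 T F) {j : ℕ}
    (hj : 1 ≤ j) (hT : j ≤ T.length) :
    ∃ x < F.length, currentStart F j = (F.take x).flatten.length + 1 ∧
      (F.take x).flatten.length < j ∧ j ≤ (F.take (x + 1)).flatten.length := by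
  have hF : 0 < F.length := by
    rw [List.length_pos_iff]
    rintro rfl
    rw [← h.1] at hT
    simp at hT
    omega
  have hspec := Nat.findGreatest_spec
    (P := fun x => x < F.length ∧ (F.take x).flatten.length < j) (Nat.zero_le F.length)
    ⟨hF, by simp; omega⟩
  have hmax : ∀ y, y < F.length → (F.take y).flatten.length < j →
      y ≤ Nat.findGreatest (fun x => x < F.length ∧ (F.take x).flatten.length < j) F.length :=
    fun y h1 h2 => Nat.le_findGreatest h1.le ⟨h1, h2⟩
  generalize Nat.findGreatest (fun x => x < F.length ∧ (F.take x).flatten.length < j) F.length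
    = x at hspec hmax
  refine ⟨x, hspec.1, le_antisymm ?_ ?_, hspec.2, ?_⟩
  · refine Finset.sup_le fun k hk => ?_
    obtain ⟨hk, hkj⟩ := Finset.mem_filter.1 hk
    obtain ⟨y, hy, rfl⟩ := mem_starts.1 hk
    have := length_flatten_take_mono F (hmax y hy hkj)
    simp only [id] at this ⊢
    omega
  · refine Finset.le_sup (f := id) (Finset.mem_filter.2 ⟨mem_starts.2 ⟨x, hspec.1, rfl⟩, ?_⟩)
    have := hspec.2
    omega
  · by_contra! hlt
    rcases Nat.lt_or_ge (x + 1) F.length with h1 | h1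
    · have := hmax (x + 1) h1 hlt
      omega
    · rw [List.take_of_length_le h1, h.1] at hlt
      omega

theorem IsLZ77.mem_starts_iff {T : List ℕ} {F : List (List ℕ)} (h : IsLZ77 T F) {i : ℕ}
    (hi : 1 ≤ i) (hT : i ≤ T.length) :
    i ∈ starts F ↔ ¬ (i - lrs T i + 1 ≤ currentStart F (i - 1)) := by
  rcases hi.eq_or_lt with rfl | hi1
  -- At position 1 no factor is current, and the empty supremum 0 makes the comparison fail, as it
  -- should.
  · rw [Nat.sub_self, currentStart_zero]
    obtain ⟨x, hx, -⟩ := exists_factor_of_pos h le_rfl hT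
    simp only [nonpos_iff_eq_zero, Nat.add_eq_zero_iff, one_ne_zero, and_false, not_false_eq_true,
      iff_true]
    exact mem_starts.2 ⟨0, by omega, by simp⟩
  · obtain ⟨x, hx, hc, hlt, hle⟩ := exists_factor_of_pos h (j := i - 1) (by omega) (by omega)
    have hfac := h.isFactor hx
    have hsucc := length_flatten_take_succ hx
    have hpT : (F.take x).flatten ++ (F.drop x).flatten = T := by
      rw [← List.flatten_append, List.take_append_drop, h.1]
    set p := (F.take x).flatten with hp
    -- Since `i - 1` lies in factor `x`, position `i` is a start exactly when that factor ends at `i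
    -- - 1`.
    have hstart : i ∈ starts F ↔ ¬ (i - p.length ≤ F[x].length) := by
      rw [mem_starts]
      constructor
      · rintro ⟨y, hy, hyi⟩ hcon
        have hxy : x + 1 ≤ y := by
          by_contra! hyx
          have := length_flatten_take_mono F (show y ≤ x by omega)
          simp only [← hp] at this
          omega
        have := length_flatten_take_mono F hxy
        simp only at this
        omega
      · intro hcon
        refine ⟨x + 1, ?_, by omega⟩
        by_contra! hge
        rw [List.take_of_length_le hge, h.1] at hsucc
        omega
    have hpre : p <+: T.take i := by
      -- The complement `g` of `p` in `T[1..i]` runs from the factor start to `i`; it has length at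
      -- least 2 because it contains `i - 1` and `i`.
      rw [List.prefix_take_iff]
      exact ⟨⟨_, hpT⟩, by omega⟩
    obtain ⟨g, hg⟩ := hpre
    have hgl : g.length = i - p.length := by
      have := congrArg List.length hg
      simp at this
      omega
    have hgR : g <+: (F.drop x).flatten := by
      rw [← List.prefix_append_right_inj p, hg, hpT]
      exact List.take_prefix _ _
    have hfR : F[x] <+: (F.drop x).flatten := by
      rw [List.drop_eq_getElem_cons hx, List.flatten_cons]
      exact List.prefix_append _ _
    have hl : i - lrs T i + 1 ≤ currentStart F (i - 1) ↔ i - p.length ≤ lrs T i := by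
      have := lrs_le T i
      rw [hc]
      omega
    rw [hstart, hl, le_lrs_iff hi hT (Nat.sub_le _ _), Nat.sub_sub_self (by omega), ← hg,
      List.drop_left, hfac.occursBefore_iff hfR hgR (by omega), hgl]

/-! ### Existence and uniqueness of the factorization -/

theorem exists_isFactor (P : List ℕ) {R : List ℕ} (hR : R ≠ []) :
    ∃ f, f <+: R ∧ IsFactor P R f := by
  obtain ⟨a, R, rfl⟩ := List.exists_cons_of_ne_nil hR
  by_cases ha : a ∈ P
  -- A letter already seen repeats by itself, so the longest repeating prefix is nonempty.
  · have h1 : 2 ≤ occ ((a :: R).take 1) (P ++ (a :: R).take 1) := by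
      rw [two_le_occ_iff (List.suffix_append _ _)]
      simpa using occursBefore_singleton.2 ha
    have hle : 1 ≤ (a :: R).length := by simp
    have hs := Nat.findGreatest_spec
      (P := fun l => 2 ≤ occ ((a :: R).take l) (P ++ (a :: R).take l)) hle h1
    have hm := fun l hl h => Nat.le_findGreatest
      (P := fun l => 2 ≤ occ ((a :: R).take l) (P ++ (a :: R).take l)) (n := (a :: R).length)
      (m := l) hl h
    have hb := Nat.findGreatest_le
      (P := fun l => 2 ≤ occ ((a :: R).take l) (P ++ (a :: R).take l)) (a :: R).length
    have h1' := hm 1 hle h1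
    generalize Nat.findGreatest (fun l => 2 ≤ occ ((a :: R).take l) (P ++ (a :: R).take l))
      (a :: R).length = l at hs hm hb h1'
    refine ⟨(a :: R).take l, List.take_prefix _ _, Or.inr ⟨?_, hs, ?_⟩⟩
    · simp
      omega
    · intro g hg h2
      rw [List.length_take, min_eq_left hb]
      refine hm _ hg.length_le ?_
      rwa [← List.prefix_iff_eq_take.1 hg]
  · exact ⟨[a], ⟨R, rfl⟩, Or.inl ⟨a, rfl, ha⟩⟩

theorem IsFactor.unique {P R f f' : List ℕ} (hf : f <+: R) (hf' : f' <+: R)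
    (h : IsFactor P R f) (h' : IsFactor P R f') : f = f' := by
  have key : ∀ {f f' : List ℕ}, f <+: R → f' <+: R → IsFactor P R f → IsFactor P R f' →
      f.length ≤ f'.length := by
    intro f f' hf hf' h h'
    rcases h with ⟨a, rfl, -⟩ | ⟨-, hocc, -⟩
    · exact List.length_pos_iff.2 h'.ne_nil
    · rcases Nat.lt_or_ge f.length 2 with hlt | hge
      · have := List.length_pos_iff.2 h'.ne_nil
        omega
      · exact (h'.occursBefore_iff hf' hf hge).1
          ((two_le_occ_iff (List.suffix_append _ _)).1 hocc)
  exact (List.prefix_of_prefix_length_le hf hf' (key hf hf' h h')).eq_of_length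
    (le_antisymm (key hf hf' h h') (key hf' hf h' h))

/-- `F` is the LZ77 factorization of `R` after the text `P`. -/
def IsLZ77After (P R : List ℕ) (F : List (List ℕ)) : Prop :=
  F.flatten = R ∧ ∀ (x : ℕ) (hx : x < F.length),
    IsFactor (P ++ (F.take x).flatten) (F.drop x).flatten F[x]

theorem isLZ77After_nil_iff {T : List ℕ} {F : List (List ℕ)} :
    IsLZ77After [] T F ↔ IsLZ77 T F := Iff.rfl

/-- Carrying the processed text `P` makes the factorization recursive in its first factor, which
drives both existence and uniqueness. -/
theorem isLZ77After_cons_iff {P R f : List ℕ} {F : List (List ℕ)} :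
    IsLZ77After P R (f :: F) ↔
      IsFactor P R f ∧ ∃ R', f ++ R' = R ∧ IsLZ77After (P ++ f) R' F := by
  constructor
  · rintro ⟨rfl, h⟩
    refine ⟨?_, F.flatten, by simp, rfl, fun x hx => ?_⟩
    · have h0 : IsFactor (P ++ []) (f ++ F.flatten) f := h 0 (by simp)
      simpa using h0
    · have h1 : IsFactor (P ++ (f ++ (F.take x).flatten)) (F.drop x).flatten F[x] :=
        h (x + 1) (by simpa using hx)
      simpa using h1
  · rintro ⟨h0, R', rfl, rfl, h⟩
    refine ⟨by simp, fun x hx => ?_⟩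
    cases x with
    | zero => simpa using h0
    | succ x => simpa using h x (by simpa using hx)

theorem exists_isLZ77After (P R : List ℕ) : ∃ F, IsLZ77After P R F := by
  by_cases hR : R = []
  · exact ⟨[], by simp [hR], fun x hx => by simp at hx⟩
  · obtain ⟨f, ⟨R', hf⟩, hfac⟩ := exists_isFactor P hR
    have hlt : R'.length < R.length := by
      have := List.length_pos_iff.2 hfac.ne_nil
      rw [← hf, List.length_append]
      omega
    obtain ⟨F, hF⟩ := exists_isLZ77After (P ++ f) R'
    exact ⟨f :: F, isLZ77After_cons_iff.2 ⟨hfac, R', hf, hF⟩⟩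
termination_by R.length

theorem IsLZ77After.unique {P R : List ℕ} {F F' : List (List ℕ)} (h : IsLZ77After P R F)
    (h' : IsLZ77After P R F') : F = F' := by
  induction F generalizing P R F' with
  | nil =>
    cases F' with
    | nil => rfl
    | cons f' F' =>
      obtain ⟨hf, R', hR, -⟩ := isLZ77After_cons_iff.1 h'
      rw [← h.1] at hR
      simp at hR
      exact absurd hR.1 hf.ne_nil
  | cons f F ih =>
    obtain ⟨hf, R', hR, hF⟩ := isLZ77After_cons_iff.1 h
    cases F' with
    | nil =>
      rw [← h'.1] at hR
      simp at hR
      exact absurd hR.1 hf.ne_nil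
    | cons f' F' =>
      obtain ⟨hf', R'', hR', hF'⟩ := isLZ77After_cons_iff.1 h'
      obtain rfl := hf.unique ⟨_, hR⟩ ⟨_, hR'⟩ hf'
      obtain rfl : R' = R'' := List.append_cancel_left (hR.trans hR'.symm)
      rw [ih hF hF']

/-! ### Factor starts as a recursion on the text alone -/

/-- The start of the current factor, computed by the rule. -/
def ruleStart (T : List ℕ) : ℕ → ℕ
  | 0 => 0
  | j + 1 => if j + 1 - lrs T (j + 1) + 1 ≤ ruleStart T j then ruleStart T j else j + 1

theorem ruleStart_le (T : List ℕ) (j : ℕ) : ruleStart T j ≤ j := by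
  induction j with
  | zero => rfl
  | succ j ih =>
    rw [ruleStart]
    split_ifs
    · omega
    · rfl

/-- The right side does not depend on `i`: by `lrs_take`, the rule at `j` sees only `T[1..j]`. Hence
one sequence of reports serves every prefix. -/
theorem IsLZ77.currentStart_eq {T : List ℕ} {F : List (List ℕ)} {i : ℕ}
    (h : IsLZ77 (T.take i) F) (hT : i ≤ T.length) {j : ℕ} (hj : j ≤ i) :
    currentStart F j = ruleStart T j := by
  induction j with
  | zero => exact currentStart_zero F
  | succ j ih =>
    have hm := h.mem_starts_iff (i := j + 1) (by omega) (by simp; omega)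
    rw [lrs_take hj, Nat.add_sub_cancel, ih (by omega)] at hm
    rw [currentStart_succ, ruleStart, ih (by omega)]
    by_cases hc : j + 1 - lrs T (j + 1) + 1 ≤ ruleStart T j
    · rw [if_pos hc, if_neg (by rw [hm]; simpa using hc)]
    · rw [if_neg hc, if_pos (hm.2 hc)]

/-! ### Fresh registers -/

/-- A strict upper bound on the registers that a program mentions. -/
def Prog.regBound : Prog → ℕ
  | .const r _ => r + 1
  | .op _ r a b => max (r + 1) (max (a + 1) (b + 1))
  | .load r a => max (r + 1) (a + 1)
  | .store a b => max (a + 1) (b + 1)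
  | .seq P Q => max P.regBound Q.regBound
  | .branch r P Q => max (r + 1) (max P.regBound Q.regBound)
  | .loop r P => max (r + 1) P.regBound

/-- The state `s`, with the registers from `N` on replaced by those of `e`. -/
def State.overlay {w : ℕ} (N : ℕ) (s : State w) (e : ℕ → BitVec w) : State w where
  reg r := if r < N then s.reg r else e r
  mem := s.mem

theorem State.overlay_reg {w N : ℕ} {s : State w} {e : ℕ → BitVec w} {r : ℕ} (h : r < N) :
    (s.overlay N e).reg r = s.reg r := if_pos h

theorem State.overlay_mem {w N : ℕ} {s : State w} {e : ℕ → BitVec w} :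
    (s.overlay N e).mem = s.mem := rfl

theorem State.overlay_setReg {w N : ℕ} {s : State w} {e : ℕ → BitVec w} {r : ℕ} (h : r < N)
    (v : BitVec w) : (s.setReg r v).overlay N e = (s.overlay N e).setReg r v := by
  ext k : 2
  · simp only [State.overlay, State.setReg, Function.update_apply]
    split_ifs <;> first | rfl | omega
  · rfl

theorem State.overlay_setMem {w N : ℕ} {s : State w} {e : ℕ → BitVec w} (a v : BitVec w) :
    (s.setMem a v).overlay N e = (s.overlay N e).setMem a v := rfl

/-- Registers from `N` on are invisible to `P`, so data kept there survives its run at no cost in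
time or space. -/
theorem Exec.overlay {w M N : ℕ} {P : Prog} {s s' : State w} {t : ℕ} (h : Exec M P s s' t)
    (hN : P.regBound ≤ N) (e : ℕ → BitVec w) :
    Exec M P (s.overlay N e) (s'.overlay N e) t := by
  induction h with
  | const s r c =>
    simp only [Prog.regBound] at hN
    rw [State.overlay_setReg (by omega)]
    exact .const _ _ _
  | op s o r a b =>
    simp only [Prog.regBound] at hN
    rw [State.overlay_setReg (by omega), ← State.overlay_reg (e := e) (show a < N by omega),
      ← State.overlay_reg (s := s) (e := e) (show b < N by omega)]
    exact .op _ _ _ _ _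
  | load s r a h =>
    simp only [Prog.regBound] at hN
    have ha := State.overlay_reg (s := s) (e := e) (show a < N by omega)
    rw [State.overlay_setReg (by omega), ← ha, ← State.overlay_mem (s := s) (N := N) (e := e)]
    exact .load _ _ _ (by rwa [ha])
  | store s a b h =>
    simp only [Prog.regBound] at hN
    have ha := State.overlay_reg (s := s) (e := e) (show a < N by omega)
    rw [State.overlay_setMem, ← ha,
      ← State.overlay_reg (s := s) (e := e) (show b < N by omega)]
    exact .store _ _ _ (by rwa [ha])
  | seq _ _ ih ih' =>
    simp only [Prog.regBound] at hN
    exact .seq (ih (by omega)) (ih' (by omega))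
  | branch_true h0 _ ih =>
    simp only [Prog.regBound] at hN
    exact .branch_true (by rwa [State.overlay_reg (by omega)]) (ih (by omega))
  | branch_false h0 _ ih =>
    simp only [Prog.regBound] at hN
    exact .branch_false (by rwa [State.overlay_reg (by omega)]) (ih (by omega))
  | loop_true h0 _ _ ih ih' =>
    have hN' := hN
    simp only [Prog.regBound] at hN'
    exact .loop_true (by rwa [State.overlay_reg (by omega)]) (ih (by omega)) (ih' hN)
  | loop_false h0 =>
    simp only [Prog.regBound] at hN
    exact .loop_false (by rwa [State.overlay_reg (by omega)])

theorem Exec.time_pos {w M : ℕ} {P : Prog} {s s' : State w} {t : ℕ} (h : Exec M P s s' t) :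
    1 ≤ t := by
  induction h <;> omega

/-! ### The program that computes the reports -/

/-- The part of a round that reads the record of the leaf and computes the reports. It uses the
registers `N` (longest repeating suffix), `N + 1` (current start), `N + 2` (flag), `N + 3` (length
of the text) and, temporarily, `N + 4` and `N + 5`. -/
def reportProg (leaf fromOff toOff N : ℕ) : Prog :=
  .seq (.const (N + 4) 1) <|
  .seq (.op .add (N + 3) (N + 3) (N + 4)) <|
  .seq (.const (N + 4) toOff) <|
  .seq (.op .add (N + 4) leaf (N + 4)) <|
  .seq (.load (N + 4) (N + 4)) <|
  .seq (.const (N + 5) fromOff) <|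
  .seq (.op .add (N + 5) leaf (N + 5)) <|
  .seq (.load (N + 5) (N + 5)) <|
  .seq (.op .sub (N + 4) (N + 4) (N + 5)) <|
  .seq (.op .sub N (N + 3) (N + 4)) <|
  -- With `N + 4` holding `i - LRS[i]`, the strict comparison with `s` avoids adding 1 and hence
  -- overflow.
  .seq (.op .lt (N + 2) (N + 4) (N + 1)) <|
  .seq (.branch (N + 2) (.const (N + 2) 0)
    -- The disjunction of a word with itself copies it.
    (.seq (.const (N + 2) 1) (.op .bor (N + 1) (N + 3) (N + 3)))) <|
  .seq (.const (N + 4) 0) (.const (N + 5) 0)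

/-- The contents of the report registers. -/
def reportRegs {w : ℕ} (N : ℕ) (l s f c : BitVec w) (r : ℕ) : BitVec w :=
  if r = N then l else if r = N + 1 then s else if r = N + 2 then f else if r = N + 3 then c else 0

/-- The bound 16 is 11 straight-line steps, at most 3 for the branch, and 2 to clear the
temporaries. -/
theorem exec_reportProg {w M N leaf fromOff toOff : ℕ} (a : State w) (l s f c : BitVec w)
    (hw : 1 ≤ w) (hleaf : leaf < N)
    (hto : (a.reg leaf + BitVec.ofNat w toOff).toNat < M)
    (hfrom : (a.reg leaf + BitVec.ofNat w fromOff).toNat < M) {d : BitVec w}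
    (hd : d = a.mem (a.reg leaf + BitVec.ofNat w toOff) -
      a.mem (a.reg leaf + BitVec.ofNat w fromOff)) :
    ∃ t ≤ 16, Exec M (reportProg leaf fromOff toOff N) (a.overlay N (reportRegs N l s f c))
      (a.overlay N (reportRegs N (c + 1 - d) (if d < s then s else c + 1)
        (if d < s then 0 else 1) (c + 1))) t := by
  have hne : leaf ≠ N + 3 ∧ leaf ≠ N + 4 ∧ leaf ≠ N + 5 := by omega
  suffices h : ∃ t ≤ 16, ∃ s', Exec M (reportProg leaf fromOff toOff N)
      (a.overlay N (reportRegs N l s f c)) s' t ∧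
      s' = a.overlay N (reportRegs N (c + 1 - d) (if d < s then s else c + 1)
        (if d < s then 0 else 1) (c + 1)) by
    obtain ⟨t, ht, s', h, rfl⟩ := h
    exact ⟨t, ht, h⟩
  have hreg : ∀ (b : State w) (r k : ℕ) (v : BitVec w),
      (b.setReg r v).reg k = if k = r then v else b.reg k := fun b r k v => by
    simp [State.setReg, Function.update_apply]
  have hmem : ∀ (b : State w) (r : ℕ) (v : BitVec w), (b.setReg r v).mem = b.mem :=
    fun _ _ _ => rfl
  by_cases hds : d < s
  · refine ⟨_, ?_, _, .seq (.const _ _ _) <| .seq (.op _ _ _ _ _) <| .seq (.const _ _ _) <|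
      .seq (.op _ _ _ _ _) <| .seq (.load _ _ _ ?_) <| .seq (.const _ _ _) <|
      .seq (.op _ _ _ _ _) <| .seq (.load _ _ _ ?_) <| .seq (.op _ _ _ _ _) <|
      .seq (.op _ _ _ _ _) <| .seq (.op _ _ _ _ _) <|
      .seq (.branch_true ?_ (.const _ _ _)) <| .seq (.const _ _ _) (.const _ _ _), ?_⟩
    · norm_num
    · simpa [hreg, hmem, State.overlay, reportRegs, Op.eval, hleaf, hne] using hto
    · simpa [hreg, hmem, State.overlay, reportRegs, Op.eval, hleaf, hne] using hfrom
    -- The words 1 and 0 differ only because `1 ≤ w`.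
    · simp [hreg, hmem, State.overlay, reportRegs, Op.eval, hleaf, hne, ← hd, hds]
      omega
    · ext k : 2
      · simp [hreg, hmem, State.overlay, reportRegs, Op.eval, hleaf, hne, ← hd, hds]
        split_ifs <;> first | rfl | omega
      · rfl
  · refine ⟨_, ?_, _, .seq (.const _ _ _) <| .seq (.op _ _ _ _ _) <| .seq (.const _ _ _) <|
      .seq (.op _ _ _ _ _) <| .seq (.load _ _ _ ?_) <| .seq (.const _ _ _) <|
      .seq (.op _ _ _ _ _) <| .seq (.load _ _ _ ?_) <| .seq (.op _ _ _ _ _) <|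
      .seq (.op _ _ _ _ _) <| .seq (.op _ _ _ _ _) <|
      .seq (.branch_false ?_ (.seq (.const _ _ _) (.op _ _ _ _ _))) <|
      .seq (.const _ _ _) (.const _ _ _), ?_⟩
    · norm_num
    · simpa [hreg, hmem, State.overlay, reportRegs, Op.eval, hleaf, hne] using hto
    · simpa [hreg, hmem, State.overlay, reportRegs, Op.eval, hleaf, hne] using hfrom
    · simp [hreg, hmem, State.overlay, reportRegs, Op.eval, hleaf, hne, ← hd, hds]
    · ext k : 2
      · simp [hreg, hmem, State.overlay, reportRegs, Op.eval, hleaf, hne, ← hd, hds]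
        split_ifs <;> first | rfl | omega
      · rfl

theorem ofNat_sub_ofNat {w x y : ℕ} (h : x ≤ y) :
    BitVec.ofNat w y - BitVec.ofNat w x = BitVec.ofNat w (y - x) := by
  rw [sub_eq_iff_eq_add, ← BitVec.ofNat_add, Nat.sub_add_cancel h]

/-- The suffixes, including the empty one, are `T.length + 1` nodes with distinct addresses. This
excludes length `2 ^ w`, which `Params` allows, so positions fit into words. -/
theorem SuffixTreeAlg.Stores.length_lt {A : SuffixTreeAlg} {w M : ℕ} {s : State w} {T : List ℕ}
    (h : A.Stores M s T) : T.length < 2 ^ w := by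
  obtain ⟨addr, hinj, -⟩ := h
  have hf : Function.Injective (fun k : Fin (T.length + 1) => addr (T.reverse.drop k)) := by
    intro a b hab
    have := congrArg List.length (hinj (Or.inl (List.drop_suffix _ _))
      (Or.inl (List.drop_suffix _ _)) hab)
    simp only [List.length_drop, List.length_reverse] at this
    exact Fin.ext (by omega)
  have := Fintype.card_le_of_injective
    (fun k : Fin (T.length + 1) => (addr (T.reverse.drop k)).toFin) fun a b hab =>
      hf (BitVec.eq_of_toFin_eq hab)
  simpa using this

/-- The leaf has depth `i` and its parent depth `lrs T i`, so the edge label has length `i - lrs T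
i`. -/
theorem SuffixTreeAlg.Stores.exists_leaf {A : SuffixTreeAlg} {w M : ℕ} {s : State w}
    {T : List ℕ} {i : ℕ} (hi : 1 ≤ i) (hT : i ≤ T.length) (h : A.Stores M s (T.take i)) :
    (s.reg A.leafReg + BitVec.ofNat w A.toOff).toNat < M ∧
    (s.reg A.leafReg + BitVec.ofNat w A.fromOff).toNat < M ∧
    s.mem (s.reg A.leafReg + BitVec.ofNat w A.toOff) -
      s.mem (s.reg A.leafReg + BitVec.ofNat w A.fromOff) = BitVec.ofNat w (i - lrs T i) := by
  obtain ⟨addr, -, -, hleaf, hrec⟩ := h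
  obtain ⟨u, hu, hul⟩ := exists_isParent_length_eq_lrs hi hT
  obtain ⟨hM, -, x, y, hxy, hy, hx', hy', hv⟩ := hrec _ _ (Or.inl List.suffix_rfl) hu
  rw [hleaf]
  have hadd : ∀ k ∈ [A.parentOff, A.fromOff, A.toOff],
      (addr (T.take i).reverse + BitVec.ofNat w k).toNat < M := by
    intro k hk
    obtain ⟨h1, h2⟩ := hM k hk
    rw [BitVec.toNat_add, BitVec.toNat_ofNat, Nat.add_mod_mod, Nat.mod_eq_of_lt h2]
    exact h1
  refine ⟨hadd _ (by simp), hadd _ (by simp), ?_⟩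
  have hl := congrArg List.length hv
  simp only [List.length_reverse, List.length_take, List.length_append, List.length_drop, hul]
    at hl hy
  rw [show i - lrs T i = y - x by omega, ← ofNat_sub_ofNat hxy, ← hx', ← hy',
    BitVec.ofNat_toNat, BitVec.ofNat_toNat]
  simp

/-! ### The rule carried out by the machine -/

/-- The decision of the rule: `1` if position `i` starts a new factor. -/
def ruleFlag (T : List ℕ) (i : ℕ) : ℕ :=
  if i = 0 ∨ i - lrs T i + 1 ≤ ruleStart T (i - 1) then 0 else 1

/-- The contents of the report registers after round `i`. -/
def roundRegs (w N : ℕ) (T : List ℕ) (i : ℕ) : ℕ → BitVec w :=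
  reportRegs N (BitVec.ofNat w (lrs T i)) (BitVec.ofNat w (ruleStart T i))
    (BitVec.ofNat w (ruleFlag T i)) (BitVec.ofNat w i)

/-- A strict upper bound on the registers that an online suffix tree algorithm uses. -/
def SuffixTreeAlg.regBound (A : SuffixTreeAlg) : ℕ :=
  max A.prog.regBound (max (A.leafReg + 1) 2)

/-- The online LZ77 algorithm on top of an online suffix tree algorithm. -/
def SuffixTreeAlg.toLZAlg (A : SuffixTreeAlg) : LZAlg where
  prog := .seq A.prog (reportProg A.leafReg A.fromOff A.toOff A.regBound)
  lrsReg := A.regBound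
  startReg := A.regBound + 1
  flagReg := A.regBound + 2

theorem SuffixTreeAlg.Stores.exec_report {A : SuffixTreeAlg} {w M : ℕ} {s : State w}
    {T : List ℕ} {i : ℕ} (hT : i + 1 ≤ T.length) (h : A.Stores M s (T.take (i + 1))) :
    ∃ t ≤ 16, Exec M (reportProg A.leafReg A.fromOff A.toOff A.regBound)
      (s.overlay A.regBound (roundRegs w A.regBound T i))
      (s.overlay A.regBound (roundRegs w A.regBound T (i + 1))) t := by
  have hlt := h.length_lt
  rw [List.length_take, min_eq_left hT] at hlt
  have hw : 1 ≤ w := by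
    by_contra! hw
    obtain rfl : w = 0 := by omega
    simp at hlt
  obtain ⟨hto, hfrom, hd⟩ := h.exists_leaf (by omega) hT
  have hl := lrs_lt (by omega) hT
  have hs := ruleStart_le T i
  have hex := exec_reportProg (N := A.regBound) s (BitVec.ofNat w (lrs T i))
    (BitVec.ofNat w (ruleStart T i)) (BitVec.ofNat w (ruleFlag T i)) (BitVec.ofNat w i) hw
    (by simp [SuffixTreeAlg.regBound]) hto hfrom hd.symm
  have h1 : BitVec.ofNat w i + 1 = BitVec.ofNat w (i + 1) := by
    rw [BitVec.ofNat_add]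
    rfl
  have h2 : BitVec.ofNat w (i + 1) - BitVec.ofNat w (i + 1 - lrs T (i + 1)) =
      BitVec.ofNat w (lrs T (i + 1)) := by
    rw [ofNat_sub_ofNat (Nat.sub_le _ _), Nat.sub_sub_self hl.le]
  -- Both numbers are below `2 ^ w`, so comparing words compares the numbers.
  have h3 : BitVec.ofNat w (i + 1 - lrs T (i + 1)) < BitVec.ofNat w (ruleStart T i) ↔
      i + 1 - lrs T (i + 1) + 1 ≤ ruleStart T i := by
    rw [BitVec.lt_def, BitVec.toNat_ofNat, BitVec.toNat_ofNat, Nat.mod_eq_of_lt (by omega),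
      Nat.mod_eq_of_lt (by omega), Nat.succ_le_iff]
  simp only [h1, h2, h3] at hex
  have hregs : roundRegs w A.regBound T (i + 1) =
      reportRegs A.regBound (BitVec.ofNat w (lrs T (i + 1)))
        (if i + 1 - lrs T (i + 1) + 1 ≤ ruleStart T i then BitVec.ofNat w (ruleStart T i)
          else BitVec.ofNat w (i + 1))
        (if i + 1 - lrs T (i + 1) + 1 ≤ ruleStart T i then 0 else 1)
        (BitVec.ofNat w (i + 1)) := by
    simp only [roundRegs, ruleStart, ruleFlag, Nat.add_sub_cancel, Nat.add_eq_zero_iff,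
      one_ne_zero, and_false, false_or]
    split_ifs <;> rfl
  rw [hregs]
  exact hex

/-- The convention `ruleFlag T 0 = 0` lets the invariant start from the zero registers, without an
initialization phase. -/
theorem roundRegs_zero (w N : ℕ) (T : List ℕ) : roundRegs w N T 0 = fun _ => 0 := by
  funext r
  simp [roundRegs, reportRegs, ruleFlag, ruleStart, lrs]

theorem initial_overlay (p : Params) {N : ℕ} (hN : 2 ≤ N) :
    (initial p).overlay N (fun _ => 0) = initial p := by
  ext k : 2
  · simp only [initial, State.overlay, State.setReg, Function.update_apply]
    split_ifs <;> first | rfl | omega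
  · rfl

theorem SuffixTreeAlg.SolvesSuffixUpdate.toLZAlg_computesLZ77 {A : SuffixTreeAlg}
    {R : Set Params} {time : Params → ℕ} {space : Params → ℕ → ℕ}
    (h : A.SolvesSuffixUpdate R time space) :
    A.toLZAlg.ComputesLZ77 R (fun p => 17 * time p) space := by
  intro p hp T hT
  obtain ⟨s, ⟨hs0, hs⟩, hst⟩ := h p hp T hT
  have hTn := hT.1
  have hlt : ∀ i ≤ p.n, i < 2 ^ p.w := by
    intro i hi
    rcases Nat.eq_zero_or_pos i with rfl | hi0
    · positivity
    · have := (hst i hi0 hi).length_lt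
      rwa [List.length_take, min_eq_left (by omega)] at this
  have hN2 : 2 ≤ A.regBound := by simp [SuffixTreeAlg.regBound]
  have hNP : A.prog.regBound ≤ A.regBound := by simp [SuffixTreeAlg.regBound]
  have hlrs : ∀ i, ((s i).overlay A.regBound (roundRegs p.w A.regBound T i)).reg
      A.toLZAlg.lrsReg = BitVec.ofNat p.w (lrs T i) := by
    intro i
    simp [State.overlay, SuffixTreeAlg.toLZAlg, roundRegs, reportRegs]
  have hstart : ∀ i, ((s i).overlay A.regBound (roundRegs p.w A.regBound T i)).reg
      A.toLZAlg.startReg = BitVec.ofNat p.w (ruleStart T i) := by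
    intro i
    simp [State.overlay, SuffixTreeAlg.toLZAlg, roundRegs, reportRegs]
  have hflag : ∀ i, ((s i).overlay A.regBound (roundRegs p.w A.regBound T i)).reg
      A.toLZAlg.flagReg = BitVec.ofNat p.w (ruleFlag T i) := by
    intro i
    simp [State.overlay, SuffixTreeAlg.toLZAlg, roundRegs, reportRegs]
  have hlrsN : ∀ i ≤ p.n, (BitVec.ofNat p.w (lrs T i)).toNat = lrs T i := fun i hi => by
    rw [BitVec.toNat_ofNat, Nat.mod_eq_of_lt ((lrs_le T i).trans_lt (hlt i hi))]
  have hstartN : ∀ i ≤ p.n, (BitVec.ofNat p.w (ruleStart T i)).toNat = ruleStart T i :=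
    fun i hi => by
      rw [BitVec.toNat_ofNat, Nat.mod_eq_of_lt ((ruleStart_le T i).trans_lt (hlt i hi))]
  refine ⟨fun i => (s i).overlay A.regBound (roundRegs p.w A.regBound T i), ⟨?_, ?_⟩, ?_, ?_, ?_⟩
  · simp only [roundRegs_zero, hs0, initial_overlay p hN2]
  · intro i hi
    obtain ⟨t, ht, hex⟩ := hs i hi
    obtain ⟨t', ht', hex'⟩ := (hst (i + 1) (by omega) (by omega)).exec_report (by omega)
    refine ⟨t + t', ?_, .seq (s' := (s (i + 1)).overlay A.regBound
      (roundRegs p.w A.regBound T i)) ?_ hex'⟩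
    -- Every round of `A` costs at least one step, so the 16 extra steps are absorbed into the
    -- factor 17.
    · have := hex.time_pos
      dsimp only
      omega
    -- The letter arrives in register 0, which lies below `A.regBound`, so supplying it commutes
    -- with the overlay.
    · rw [← State.overlay_setReg (by omega)]
      exact hex.overlay hNP _
  · intro i hi
    obtain ⟨F, hF⟩ := exists_isLZ77After [] (T.take i)
    have hF' := isLZ77After_nil_iff.1 hF
    refine ⟨F, hF', fun F' h' => (isLZ77After_nil_iff.2 h').unique hF, fun j hj hji => ?_⟩
    refine ⟨?_, ?_⟩
    · have hm := hF'.mem_starts_iff hj (by simp; omega)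
      rw [lrs_take hji, hF'.currentStart_eq (by omega) (by omega)] at hm
      simp only [hflag, ruleFlag, hm]
      split_ifs <;> first | rfl | omega
    · rw [hF'.currentStart_eq (by omega) hji]
      simp only [hstart]
      exact hstartN j (by omega)
  · intro i hi hin
    simp only [hlrs]
    exact hlrsN i hin
  · intro i hi hin
    simp only [hlrs, hstart, hflag, hlrsN i hin, hstartN (i - 1) (by omega), ruleFlag]
    split_ifs <;> first | rfl | omega

end LZOnline

theorem mainTheorem5 (R : Set LZOnline.Params) (tSU : LZOnline.Params → ℕ)
    (space : LZOnline.Params → ℕ → ℕ) (A : LZOnline.SuffixTreeAlg)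
    (hA : A.SolvesSuffixUpdate R tSU space) :
    (∃ (B : LZOnline.LZAlg) (C : ℕ), B.ComputesLZ77 R (fun p => C * tSU p) space) ∧
    (∀ (T : List ℕ) (F : List (List ℕ)), LZOnline.IsLZ77 T F →
      ∀ i, 1 < i → i ≤ T.length →
        (i ∈ LZOnline.starts F ↔
          ¬ (i - LZOnline.lrs T i + 1 ≤ LZOnline.currentStart F (i - 1)))) := by
  exact ⟨⟨A.toLZAlg, 17, hA.toLZAlg_computesLZ77⟩,
    fun T F hF i hi hT => hF.mem_starts_iff hi.le hT⟩
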